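/- Let $n$ be a positive integer and let $\mathrm{Coup}(E)=([n],E)$ be a connected simple graph on $[n]=\{1,\dots,n\}$ that is neither the complete graph $K_n$ nor (isomorphic to) the 4-cycle $C_4$. Let $\mathbb{S}_n$ be the symmetric group on $[n]$, let $T=\{(i\ j)\in\mathbb{S}_n : \{i,j\}\in E\}$, and let $\mathrm{Cay}(\mathbb{S}_n,T)$ be the Cayley graph with vertex set $\mathbb{S}_n$ and arcs $(\tau,\tau\sigma)$ for $\tau\in\mathbb{S}_n$, $\sigma\in T$. Let $g=\{q_1,q_2\}\subseteq[n]$ with $q_1\neq q_2$ be a two-element set (a gate), and let $$F=\{\tau\in\mathbb{S}_n : \tau^{-1}(g)=\{\tau^{-1}(q_1),\tau^{-1}(q_2)\}\in E\}.$$ Then the group $$\mathrm{Aut}(\mathrm{Cay}(\mathbb{S}_n,T),F)=\{\rho\in\mathrm{Aut}(\mathrm{Cay}(\mathbb{S}_n,T)) : \rho(F)=F\}$$ of automorphisms of the Cayley graph that setwise fix $F$ is isomorphic, as a group, to $\mathbb{S}_n(g)\times\mathrm{Aut}(\mathrm{Coup}(E))$, where $\mathbb{S}_n(g)=\{\tau\in\mathbb{S}_n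 : \tau(g)=g\}$ is the setwise stabilizer of $g$. -/

import Mathlib

open scoped Pointwise

namespace NNCP

/-- The transpositions `(i j)` of `S_n` for which `{i, j}` is an edge of the coupling graph. -/
def transpositions {n : ℕ} (Coup : SimpleGraph (Fin n)) : Set (Equiv.Perm (Fin n)) :=
  {σ | ∃ i j : Fin n, Coup.Adj i j ∧ σ = Equiv.swap i j}

/-- The Cayley graph of `S_n` with respect to the transpositions of the coupling graph. -/
abbrev cay {n : ℕ} (Coup : SimpleGraph (Fin n)) : SimpleGraph (Equiv.Perm (Fin n)) :=
  SimpleGraph.mulCayley (transpositions Coup)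

/-- The arcs of `cay Coup` are exactly the pairs `(τ, τ σ)` with `σ` in the connection set: the
set of transpositions is closed under inverses and does not contain the identity, so the
undirected and the directed Cayley graph have the same adjacency relation. -/
theorem cay_adj {n : ℕ} (Coup : SimpleGraph (Fin n)) (τ₁ τ₂ : Equiv.Perm (Fin n)) :
    (cay Coup).Adj τ₁ τ₂ ↔ ∃ σ ∈ transpositions Coup, τ₂ = τ₁ * σ := by
  rw [SimpleGraph.mulCayley_adj']
  constructor
  · rintro ⟨-, σ, ⟨i, j, hij, rfl⟩, h | h⟩
    · exact ⟨_, ⟨i, j, hij, rfl⟩, h.symm⟩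
    · exact ⟨_, ⟨i, j, hij, rfl⟩, by rw [h, mul_assoc, Equiv.swap_mul_self, mul_one]⟩
  · rintro ⟨σ, ⟨i, j, hij, rfl⟩, rfl⟩
    refine ⟨fun h => hij.ne ?_, _, ⟨i, j, hij, rfl⟩, Or.inl rfl⟩
    exact Equiv.swap_eq_one_iff.mp (mul_eq_left.mp h.symm)

/-- The qubit orders `τ` complying with the gate `g`, i.e. `τ⁻¹(g)` is an edge of the coupling
graph. -/
def compliant {n : ℕ} (Coup : SimpleGraph (Fin n)) (g : Sym2 (Fin n)) :
    Set (Equiv.Perm (Fin n)) :=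
  {τ | Sym2.map (τ⁻¹ : Equiv.Perm (Fin n)) g ∈ Coup.edgeSet}

/-- The subgroup of `Aut(X)` of the automorphisms that fix the vertex set `F` setwise. -/
def autFixing {V : Type*} (X : SimpleGraph V) (F : Set V) : Subgroup (X ≃g X) where
  carrier := {ρ | ρ '' F = F}
  one_mem' := Set.image_id F
  mul_mem' {ρ₁ ρ₂} h₁ h₂ := by
    change (fun x => ρ₁ (ρ₂ x)) '' F = F
    rw [← Set.image_image, show ρ₂ '' F = F from h₂, show ρ₁ '' F = F from h₁]
  inv_mem' {ρ} h := by
    change ρ.symm '' F = F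
    conv_lhs => rw [← show ρ '' F = F from h]
    simp [Set.image_image]

/-- The setwise stabilizer of `S` in the symmetric group `S_n`. -/
abbrev symStabilizer {n : ℕ} (S : Set (Fin n)) : Subgroup (Equiv.Perm (Fin n)) :=
  MulAction.stabilizer (Equiv.Perm (Fin n)) S

end NNCP

/-! The maps `x ↦ a x b⁻¹`, with `a` a permutation and `b` an automorphism of `Coup`, are
automorphisms of the Cayley graph. The core is that there are no others
(`biTranslationHom_surjective`).

Near each `x` the neighbours `x * swap i j` correspond to edges of `Coup`. Common neighbours detect
whether edges meet and tell triangles from stars, so by a Whitney-type argument `ρ` acts near `x`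
through an automorphism `b x` of `Coup` (`exists_isLocalAction`). Applying `ρ` to the short
relations between transpositions (involution, commutation, triangle, braid) shows that `b` is
constant along arcs (`turn_eq_one`). Since the transpositions generate the symmetric group, `ρ` is a
two-sided translation. The exclusions matter: on `K_n` inversion is an automorphism whose `turn`
along `i j` is `swap i j`.

Finally `F` is invariant under the `b`-part, while the `a`-part replaces `g` by another pair. As `F`
determines `g` (`eq_of_forall_perm`), preserving `F` means that `a` stabilizes `g`. -/

namespace NNCP
open Equiv SimpleGraph

/-! ### Factorizations into two transpositions -/

section Swap
variable {α : Type*} [DecidableEq α]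

theorem sym2_eq_of_swap_eq {a b c d : α} (hab : a ≠ b) (h : swap a b = swap c d) :
    s(a, b) = s(c, d) := by
  have h₁ : swap c d a = b := by rw [← h, swap_apply_left]
  rw [swap_apply_def] at h₁
  rw [Sym2.eq_iff]
  grind

/-- Were `e` fixed, `swap a b` would send `f` to `e`, so the two factors would coincide and cancel.
Thus the right factor lives on the support of `π`, which makes the factorization lemmas finite
checks. -/
theorem apply_ne_self_of_eq_swap_mul_swap {a b e f : α} {π : Perm α} (hef : e ≠ f)
    (h : π = swap a b * swap e f) (hπ : π ≠ 1) : π e ≠ e := by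
  intro he
  apply hπ
  have h₁ : swap a b f = e := by
    rw [← he, h, Perm.mul_apply, swap_apply_left]
  have h₂ : swap a b = swap e f := by
    rw [swap_apply_def] at h₁
    have : (a = e ∧ b = f) ∨ (a = f ∧ b = e) := by grind
    rcases this with ⟨rfl, rfl⟩ | ⟨rfl, rfl⟩
    · rfl
    · exact swap_comm _ _
  rw [h, h₂, swap_mul_self]

/-- The only factorizations of a product of two disjoint transpositions. -/
theorem factor_of_disjoint {i j k l a b e f : α} (hij : i ≠ j) (hkl : k ≠ l) (hik : i ≠ k)
    (hil : i ≠ l) (hjk : j ≠ k) (hjl : j ≠ l) (hef : e ≠ f)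
    (h : swap i j * swap k l = swap a b * swap e f) :
    s(e, f) = s(i, j) ∨ s(e, f) = s(k, l) := by
  have key : ∀ p, swap i j (swap k l p) = swap a b (swap e f p) := fun p => by
    rw [← Perm.mul_apply, h, Perm.mul_apply]
  have hne : swap i j * swap k l ≠ 1 := fun h1 => by
    have := DFunLike.congr_fun h1 i
    simp [swap_apply_def] at this
    grind
  have he := apply_ne_self_of_eq_swap_mul_swap hef h hne
  have hf := apply_ne_self_of_eq_swap_mul_swap hef.symm (swap_comm e f ▸ h) hne
  rw [Perm.mul_apply] at he hf
  have h1 := key i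
  have h2 := key j
  have h3 := key k
  have h4 := key l
  clear key
  simp only [swap_apply_def] at *
  simp only [Sym2.eq_iff]
  grind (splits := 20)

/-- Every factorization of a 3-cycle into two transpositions takes place on its support. -/
theorem factor_of_threeCycle {i j k a b e f : α} (hik : i ≠ k) (hjk : j ≠ k)
    (hef : e ≠ f) (h : swap i j * swap i k = swap a b * swap e f) :
    s(e, f) = s(i, j) ∨ s(e, f) = s(i, k) ∨ s(e, f) = s(j, k) := by
  have hne : swap i j * swap i k ≠ 1 := fun h1 => by
    have := DFunLike.congr_fun h1 i
    simp [swap_apply_def] at this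
    grind
  have he := apply_ne_self_of_eq_swap_mul_swap hef h hne
  have hf := apply_ne_self_of_eq_swap_mul_swap hef.symm (swap_comm e f ▸ h) hne
  rw [Perm.mul_apply] at he hf
  simp only [swap_apply_def] at he hf
  simp only [Sym2.eq_iff]
  grind

/-- Five transpositions through `i` that multiply to no transposition. -/
theorem star_product_ne_swap {i j k k' j₃ j₅ a b : α} (hij : i ≠ j) (hik : i ≠ k) (hik' : i ≠ k')
    (hjk : j ≠ k) (hjk' : j ≠ k') (hkk' : k ≠ k') (h₃ : j₃ ≠ k') (h₃' : j₃ ≠ i) (h₅ : j₅ ≠ k)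
    (h₅' : j₅ ≠ i) :
    swap i j * swap i k' * swap i j₃ ≠ swap i k * swap i j₅ * swap a b := by
  intro h
  have key : ∀ p, swap i j₅ (swap i k (swap i j (swap i k' (swap i j₃ p)))) = swap a b p := by
    intro p
    have := DFunLike.congr_fun h p
    simp only [Perm.mul_apply] at this
    rw [this, swap_apply_self, swap_apply_self]
  have h1 := key i
  have h2 := key j
  have h3 := key k
  have h4 := key k'
  have h5 := key j₃
  have h6 := key j₅
  clear key h
  simp only [swap_apply_def] at *
  grind
end Swap

/-! ### Edge maps induced by graph automorphisms -/

section EdgeMaps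
variable {V : Type*} {G : SimpleGraph V}

/-- In a connected graph, every proper nonempty vertex set is left by an edge. -/
theorem exists_adj_leaving (hG : G.Connected) {S : Set V} {u v : V} (hu : u ∈ S) (hv : v ∉ S) :
    ∃ a ∈ S, ∃ b ∉ S, G.Adj a b := by
  obtain ⟨p⟩ := hG.preconnected u v
  obtain ⟨d, -, h₁, h₂⟩ := p.exists_boundary_dart S hu hv
  exact ⟨d.fst, h₁, d.snd, h₂, d.adj⟩

/-- A self-map of the edges that preserves and reflects the incidence of two and of three edges
comes from an automorphism (a form of Whitney's theorem). -/
theorem exists_iso_of_edge_map [Finite V] (hG : G.Connected)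
    (hV : ∀ u v : V, ∃ w, w ≠ u ∧ w ≠ v) (β : Sym2 V → Sym2 V)
    (hβ : ∀ e ∈ G.edgeSet, β e ∈ G.edgeSet)
    (hinj : ∀ e ∈ G.edgeSet, ∀ f ∈ G.edgeSet, β e = β f → e = f)
    (hmeet : ∀ e ∈ G.edgeSet, ∀ f ∈ G.edgeSet, e ≠ f →
      ((∃ v, v ∈ e ∧ v ∈ f) ↔ ∃ v, v ∈ β e ∧ v ∈ β f))
    (hstar : ∀ e ∈ G.edgeSet, ∀ f ∈ G.edgeSet, ∀ h ∈ G.edgeSet, e ≠ f → e ≠ h → f ≠ h →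
      ((∃ v, v ∈ e ∧ v ∈ f ∧ v ∈ h) ↔ ∃ v, v ∈ β e ∧ v ∈ β f ∧ v ∈ β h)) :
    ∃ b : G ≃g G, ∀ e ∈ G.edgeSet, β e = e.map b := by
  have huniq : ∀ {e f : Sym2 V} {a b : V}, e ≠ f → a ∈ e → a ∈ f → b ∈ e → b ∈ f → a = b := by
    intro e f a b hne h₁ h₂ h₃ h₄
    by_contra hab
    exact hne (Sym2.eq_of_ne_mem hab h₁ h₃ h₂ h₄)
  have hbranch : ∀ v, ∀ e ∈ G.edgeSet, ∀ f ∈ G.edgeSet, e ≠ f → v ∈ e → v ∈ f →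
      ∃ w, ∀ h ∈ G.edgeSet, v ∈ h ↔ w ∈ β h := by
    intro v e he f hf hne hve hvf
    obtain ⟨w, hwe, hwf⟩ := (hmeet e he f hf hne).1 ⟨v, hve, hvf⟩
    refine ⟨w, fun h hh => ?_⟩
    by_cases heh : e = h
    · subst heh; exact iff_of_true hve hwe
    by_cases hfh : f = h
    · subst hfh; exact iff_of_true hvf hwf
    constructor
    · intro hvh
      obtain ⟨w', h₁, h₂, h₃⟩ := (hstar e he f hf h hh hne heh hfh).1 ⟨v, hve, hvf, hvh⟩
      rwa [huniq (fun h => hne (hinj e he f hf h)) hwe hwf h₁ h₂]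
    · intro hwh
      obtain ⟨v', h₁, h₂, h₃⟩ := (hstar e he f hf h hh hne heh hfh).2 ⟨w, hwe, hwf, hwh⟩
      rwa [huniq hne hve hvf h₁ h₂]
  have hex : ∀ v, ∃ w, ∀ h ∈ G.edgeSet, v ∈ h ↔ w ∈ β h := by
    intro v
    obtain ⟨z, hz, -⟩ := hV v v
    obtain ⟨v', hv', u, -, hvu⟩ := exists_adj_leaving (S := {v}) hG rfl hz
    rw [Set.mem_singleton_iff.1 hv'] at hvu
    by_cases hv : ∃ f ∈ G.edgeSet, s(v, u) ≠ f ∧ v ∈ f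
    · obtain ⟨f, hf, hne, hvf⟩ := hv
      exact hbranch v _ hvu f hf hne (Sym2.mem_mk_left v u) hvf
    -- Now `v` is a leaf. Its neighbour `u` has a second edge, hence an image `w'`; the image of `v`
    -- is the other end of `β s(v, u)`.
    push Not at hv
    obtain ⟨z, hzu, hzv⟩ := hV u v
    obtain ⟨a, ha, y, hy, hay⟩ := exists_adj_leaving (S := {u, v}) hG (Set.mem_insert u _)
      (by simp [hzu, hzv] : z ∉ ({u, v} : Set V))
    simp only [Set.mem_insert_iff, Set.mem_singleton_iff, not_or] at ha hy
    have hau : a = u := by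
      rcases ha with ha | rfl
      · exact ha
      · by_contra
        refine hv s(a, y) hay ?_ (Sym2.mem_mk_left a y)
        intro h
        rw [Sym2.eq_iff] at h
        grind
    subst hau
    obtain ⟨w', hw'⟩ := hbranch a s(v, a) hvu s(a, y) hay
      (by rw [Ne, Sym2.eq_iff]; grind) (Sym2.mem_mk_right v a) (Sym2.mem_mk_left a y)
    obtain ⟨w, hw⟩ : w' ∈ β s(v, a) := (hw' _ hvu).1 (Sym2.mem_mk_right v a)
    refine ⟨w, fun h hh => ?_⟩
    by_cases heq : s(v, a) = h
    · subst heq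
      exact iff_of_true (Sym2.mem_mk_left v a) (hw ▸ Sym2.mem_mk_right w' w)
    refine iff_of_false (fun hvh => hv h hh heq hvh) fun hwh => ?_
    -- Such an `h` meets `s(v, a)`, necessarily at `a`; then `β h` contains both `w'` and `w`,
    -- against injectivity.
    obtain ⟨p, hp₁, hp₂⟩ := (hmeet _ hvu h hh heq).2 ⟨w, hw ▸ Sym2.mem_mk_right w' w, hwh⟩
    have hpa : p = a := by
      rcases Sym2.mem_iff.1 hp₁ with rfl | rfl
      · exact (hv h hh heq hp₂).elim
      · rfl
    subst hpa
    have hww : w' ≠ w := by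
      have := hβ s(v, p) hvu
      rw [hw, mem_edgeSet] at this
      exact this.ne
    exact heq (hinj _ hvu h hh (Sym2.eq_of_ne_mem hww (hw ▸ Sym2.mem_mk_left w' w)
      (hw ▸ Sym2.mem_mk_right w' w) ((hw' h hh).1 hp₂) hwh))
  choose φ hφ using hex
  have hφinj : Function.Injective φ := by
    intro u v huv
    by_contra hne
    have hiff : ∀ h ∈ G.edgeSet, u ∈ h ↔ v ∈ h := fun h hh => by rw [hφ u h hh, hφ v h hh, huv]
    obtain ⟨z, hzu, hzv⟩ := hV u v
    -- An edge leaving `{u, v}` contains exactly one of the two vertices.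
    obtain ⟨a, ha, y, hy, hay⟩ := exists_adj_leaving (S := {u, v}) hG (Set.mem_insert u _)
      (by simp [hzu, hzv] : z ∉ ({u, v} : Set V))
    have := hiff s(a, y) hay
    simp only [Set.mem_insert_iff, Set.mem_singleton_iff, not_or, Sym2.mem_iff] at ha hy this
    grind
  have hβφ : ∀ e ∈ G.edgeSet, β e = e.map φ := by
    intro e
    induction e with | _ u v
    intro he
    have hne : φ u ≠ φ v := hφinj.ne (G.ne_of_adj he)
    exact Sym2.eq_of_ne_mem hne ((hφ u _ he).1 (Sym2.mem_mk_left u v))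
      ((hφ v _ he).1 (Sym2.mem_mk_right u v)) (Sym2.mem_mk_left _ _) (Sym2.mem_mk_right _ _)
  let B : G.edgeSet → G.edgeSet := fun e => ⟨β e, hβ e e.2⟩
  have hBinj : Function.Injective B := fun e f h =>
    Subtype.ext (hinj e e.2 f f.2 (congrArg Subtype.val h))
  have hBsurj := Finite.injective_iff_surjective.1 hBinj
  refine ⟨⟨Equiv.ofBijective φ ⟨hφinj, Finite.injective_iff_surjective.1 hφinj⟩, ?_⟩, hβφ⟩
  intro u v
  change G.Adj (φ u) (φ v) ↔ G.Adj u v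
  constructor
  · intro h
    obtain ⟨⟨e, he⟩, hB⟩ := hBsurj ⟨s(φ u, φ v), h⟩
    have h₁ : e.map φ = s(u, v).map φ := (hβφ e he).symm.trans (congrArg Subtype.val hB)
    rw [Sym2.map.injective hφinj h₁] at he
    exact he
  · intro h
    have := hβ s(u, v) h
    rwa [hβφ _ h] at this

end EdgeMaps
theorem triangle_of_pairwise_meet {V : Type*} {e f h : Sym2 V} (hef : e ≠ f) (h₁ : ∃ v, v ∈ e ∧ v ∈ f)
    (h₂ : ∃ v, v ∈ e ∧ v ∈ h) (h₃ : ∃ v, v ∈ f ∧ v ∈ h) (hn : ¬ ∃ v, v ∈ e ∧ v ∈ f ∧ v ∈ h) :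
    ∃ i j k, e = s(i, j) ∧ f = s(i, k) ∧ h = s(j, k) := by
  obtain ⟨i, ⟨j, rfl⟩, ⟨k, rfl⟩⟩ := h₁
  obtain ⟨p, hp, hph⟩ := h₂
  obtain ⟨q, hq, hqh⟩ := h₃
  have hi : i ∉ h := fun hi => hn ⟨i, Sym2.mem_mk_left _ _, Sym2.mem_mk_left _ _, hi⟩
  have hpj : p = j := by
    rcases Sym2.mem_iff.1 hp with rfl | rfl
    · exact (hi hph).elim
    · rfl
  have hqk : q = k := by
    rcases Sym2.mem_iff.1 hq with rfl | rfl
    · exact (hi hqh).elim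
    · rfl
  subst hpj hqk
  have hpq : p ≠ q := fun h => hef (by rw [h])
  exact ⟨i, p, q, rfl, rfl, Sym2.eq_of_ne_mem hpq hph hqh (Sym2.mem_mk_left _ _)
    (Sym2.mem_mk_right _ _)⟩

/-! ### Automorphisms fixing the identity -/

section Cayley
variable {n : ℕ} {Coup : SimpleGraph (Fin n)}

theorem cay_adj_swap {i j : Fin n} (h : Coup.Adj i j) (τ : Perm (Fin n)) :
    (cay Coup).Adj τ (τ * swap i j) :=
  (cay_adj Coup _ _).2 ⟨_, ⟨i, j, h, rfl⟩, rfl⟩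

theorem cay_adj_iff {τ τ' : Perm (Fin n)} :
    (cay Coup).Adj τ τ' ↔ ∃ i j, Coup.Adj i j ∧ τ' = τ * swap i j := by
  rw [cay_adj]
  constructor
  · rintro ⟨_, ⟨i, j, hij, rfl⟩, rfl⟩
    exact ⟨i, j, hij, rfl⟩
  · rintro ⟨i, j, hij, rfl⟩
    exact ⟨_, ⟨i, j, hij, rfl⟩, rfl⟩

theorem swap_mul_swap_of_adj_adj {i j k l : Fin n} {y : Perm (Fin n)}
    (h₁ : (cay Coup).Adj (swap i j) y) (h₂ : (cay Coup).Adj (swap k l) y) :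
    ∃ a b e f, Coup.Adj a b ∧ Coup.Adj e f ∧ y = swap i j * swap e f ∧ y = swap k l * swap a b ∧
      swap k l * swap i j = swap a b * swap e f := by
  obtain ⟨e, f, hef, rfl⟩ := cay_adj_iff.1 h₁
  obtain ⟨a, b, hab, h⟩ := cay_adj_iff.1 h₂
  refine ⟨a, b, e, f, hab, hef, rfl, h, ?_⟩
  have h' : swap i j = swap k l * swap a b * swap e f := by
    rw [← h, mul_assoc, swap_mul_self, mul_one]
  rw [h', ← mul_assoc, ← mul_assoc, swap_mul_self, one_mul]

theorem swap_eq_of_sym2_eq {a b c d : Fin n} (h : s(a, b) = s(c, d)) : swap a b = swap c d := by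
  rcases Sym2.eq_iff.1 h with ⟨rfl, rfl⟩ | ⟨rfl, rfl⟩
  · rfl
  · exact swap_comm _ _

/-- Disjoint transpositions have a single common neighbour besides `1`. Meeting ones have none or
two, according to whether the third side is an edge; this contrast is what automorphisms preserve.
-/
theorem common_neighbor_of_disjoint {i j k l : Fin n} {y : Perm (Fin n)} (hij : i ≠ j)
    (hkl : k ≠ l) (hik : i ≠ k) (hil : i ≠ l) (hjk : j ≠ k) (hjl : j ≠ l)
    (h₁ : (cay Coup).Adj (swap i j) y) (h₂ : (cay Coup).Adj (swap k l) y) (hy : y ≠ 1) :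
    y = swap i j * swap k l := by
  obtain ⟨a, b, e, f, -, hef, rfl, -, h⟩ := swap_mul_swap_of_adj_adj h₁ h₂
  rcases factor_of_disjoint hkl hij hik.symm hjk.symm hil.symm hjl.symm hef.ne h with h | h
  · rw [swap_eq_of_sym2_eq h]
  · rw [swap_eq_of_sym2_eq h, swap_mul_self] at hy
    exact (hy rfl).elim

theorem swap_mul_swap_rotate {α : Type*} [DecidableEq α] {i j k : α} (hij : i ≠ j) (hik : i ≠ k)
    (hjk : j ≠ k) : swap i j * swap i k = swap i k * swap j k := by
  ext p
  simp only [Perm.mul_apply, swap_apply_def]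
  grind

theorem swap_conj_swap {α : Type*} [DecidableEq α] {i j k : α} (hik : i ≠ k) (hjk : j ≠ k) :
    swap i j * (swap i k * swap i j) = swap j k := by
  rw [← mul_assoc, mul_swap_eq_swap_mul (swap i j) i k, swap_apply_left,
    swap_apply_of_ne_of_ne hik.symm hjk.symm, mul_assoc, swap_mul_self, mul_one]

theorem common_neighbor_of_meet {i j k : Fin n} {y : Perm (Fin n)} (hij : i ≠ j) (hik : i ≠ k)
    (hjk : j ≠ k) (h₁ : (cay Coup).Adj (swap i j) y) (h₂ : (cay Coup).Adj (swap i k) y)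
    (hy : y ≠ 1) :
    Coup.Adj j k ∧ (y = swap i j * swap i k ∨ y = swap i k * swap i j) := by
  obtain ⟨a, b, e, f, hab, hef, he, ha, h⟩ := swap_mul_swap_of_adj_adj h₂ h₁
  rcases factor_of_threeCycle hik hjk hef.ne h with h' | h' | h'
  · rw [swap_eq_of_sym2_eq h'] at he
    refine ⟨?_, Or.inr he⟩
    have hab' : swap a b = swap j k := by
      rw [← swap_conj_swap hik hjk, ← he, ha, ← mul_assoc, swap_mul_self, one_mul]
    have := sym2_eq_of_swap_eq hab.ne hab'
    change s(j, k) ∈ Coup.edgeSet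
    rw [← this]
    exact hab
  · rw [he, swap_eq_of_sym2_eq h', swap_mul_self] at hy
    exact (hy rfl).elim
  · refine ⟨?_, Or.inl ?_⟩
    · change s(j, k) ∈ Coup.edgeSet
      rw [← h']
      exact hef
    · rw [he, swap_eq_of_sym2_eq h', swap_mul_swap_rotate hij hik hjk]

/-- An automorphism fixing the identity sends disjoint transpositions to disjoint ones. -/
theorem not_meet_of_disjoint (σ : cay Coup ≃g cay Coup) (h₁ : σ 1 = 1) {i j k l a b c : Fin n}
    (hij : Coup.Adj i j) (hkl : Coup.Adj k l) (hik : i ≠ k) (hil : i ≠ l) (hjk : j ≠ k)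
    (hjl : j ≠ l) (hab : Coup.Adj a b) (hac : Coup.Adj a c) (hbc : b ≠ c)
    (hs : σ (swap i j) = swap a b) (ht : σ (swap k l) = swap a c) : False := by
  have hcomm : swap i j * swap k l = swap k l * swap i j := by
    rw [mul_swap_eq_swap_mul, swap_apply_of_ne_of_ne hik.symm hjk.symm,
      swap_apply_of_ne_of_ne hil.symm hjl.symm]
  have hne : swap i j * swap k l ≠ 1 := fun h => by
    have := DFunLike.congr_fun h i
    simp only [Perm.mul_apply, swap_apply_of_ne_of_ne hik hil, swap_apply_left] at this
    exact hij.ne this.symm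
  have hsy : (cay Coup).Adj (swap a b) (σ (swap i j * swap k l)) := by
    rw [← hs, σ.map_adj_iff]
    exact cay_adj_swap hkl _
  have hty : (cay Coup).Adj (swap a c) (σ (swap i j * swap k l)) := by
    rw [← ht, σ.map_adj_iff, hcomm]
    exact cay_adj_swap hij _
  have hbc' := (common_neighbor_of_meet hab.ne hac.ne hbc hsy hty
    (fun h => hne (σ.injective (h.trans h₁.symm)))).1
  -- As `b c` is an edge, both 3-cycles on `a, b, c` are common neighbours; both must pull back to
  -- the one product of the disjoint pair.
  have back : ∀ z, z ≠ 1 → (cay Coup).Adj (swap a b) z → (cay Coup).Adj (swap a c) z →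
      σ.symm z = swap i j * swap k l := by
    intro z hz hz₁ hz₂
    refine common_neighbor_of_disjoint (Coup := Coup) hij.ne hkl.ne hik hil hjk hjl ?_ ?_ ?_
    · rwa [← σ.map_adj_iff, hs, σ.apply_symm_apply]
    · rwa [← σ.map_adj_iff, ht, σ.apply_symm_apply]
    · intro h
      apply hz
      rw [← h₁, ← h, σ.apply_symm_apply]
  have hrot := swap_mul_swap_rotate hab.ne hac.ne hbc
  have hrot' := swap_mul_swap_rotate hac.ne hab.ne hbc.symm
  have hne₁ : swap a b * swap a c ≠ 1 := fun h => by
    have := DFunLike.congr_fun h b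
    simp only [Perm.mul_apply, swap_apply_of_ne_of_ne hab.ne.symm hbc, swap_apply_right] at this
    exact hab.ne this
  have hne₂ : swap a c * swap a b ≠ 1 := fun h => by
    have := DFunLike.congr_fun h c
    simp only [Perm.mul_apply, swap_apply_of_ne_of_ne hac.ne.symm hbc.symm,
      swap_apply_right] at this
    exact hac.ne this
  have e₁ := back _ hne₁ (cay_adj_swap hac _) (by rw [hrot]; exact cay_adj_swap hbc' _)
  have e₂ := back _ hne₂ (by rw [hrot']; exact cay_adj_swap hbc'.symm _) (cay_adj_swap hab _)
  have := DFunLike.congr_fun (σ.symm.injective (e₁.trans e₂.symm)) b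
  simp only [Perm.mul_apply, swap_apply_of_ne_of_ne hab.ne.symm hbc, swap_apply_right,
    swap_apply_left] at this
  exact hac.ne this

/-- An automorphism fixing the identity sends no triangle to a star. -/
theorem not_star_of_triangle (σ : cay Coup ≃g cay Coup) (h₁ : σ 1 = 1) {i j k a b c d : Fin n}
    (hij : Coup.Adj i j) (hik : Coup.Adj i k) (hjk : Coup.Adj j k)
    (hab : Coup.Adj a b) (hac : Coup.Adj a c) (had : Coup.Adj a d) (hbc : b ≠ c) (hbd : b ≠ d)
    (hcd : c ≠ d) (hs : σ (swap i j) = swap a b) (ht : σ (swap i k) = swap a c)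
    (hu : σ (swap j k) = swap a d) : False := by
  have hrot := swap_mul_swap_rotate hij.ne hik.ne hjk.ne
  have hrot' : swap i j * swap i k = swap j k * swap i j := by
    rw [mul_swap_eq_swap_mul, swap_apply_left, swap_apply_of_ne_of_ne hik.ne.symm hjk.ne.symm]
  have hne : swap i j * swap i k ≠ 1 := fun h => by
    have := DFunLike.congr_fun h j
    simp only [Perm.mul_apply, swap_apply_of_ne_of_ne hij.ne.symm hjk.ne,
      swap_apply_right] at this
    exact hij.ne this
  have hy : σ (swap i j * swap i k) ≠ 1 := fun h => hne (σ.injective (h.trans h₁.symm))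
  have hsy : (cay Coup).Adj (swap a b) (σ (swap i j * swap i k)) := by
    rw [← hs, σ.map_adj_iff]
    exact cay_adj_swap hik _
  have hty : (cay Coup).Adj (swap a c) (σ (swap i j * swap i k)) := by
    rw [← ht, σ.map_adj_iff, hrot]
    exact cay_adj_swap hjk _
  have huy : (cay Coup).Adj (swap a d) (σ (swap i j * swap i k)) := by
    rw [← hu, σ.map_adj_iff, hrot']
    exact cay_adj_swap hij _
  -- The 3-cycle is adjacent to all three sides of its triangle, so its image would be a 3-cycle on
  -- `a, b, c`, fixing `d`, and also one on `a, b, d`, moving `d`.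
  have hb : σ (swap i j * swap i k) d = d := by
    rcases (common_neighbor_of_meet hab.ne hac.ne hbc hsy hty hy).2 with h | h <;>
    · rw [h]
      simp only [Perm.mul_apply, swap_apply_of_ne_of_ne had.ne.symm hbd.symm,
        swap_apply_of_ne_of_ne had.ne.symm hcd.symm]
  rcases (common_neighbor_of_meet hab.ne had.ne hbd hsy huy hy).2 with h | h <;>
  · rw [h] at hb
    simp only [Perm.mul_apply, swap_apply_right, swap_apply_left,
      swap_apply_of_ne_of_ne had.ne.symm hbd.symm] at hb
    first
    | exact hbd hb
    | exact had.ne hb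

/-- The action of an automorphism fixing the identity on the neighbours of the identity. -/
theorem exists_iso_of_map_one (hconn : Coup.Connected)
    (hV : ∀ u v : Fin n, ∃ w, w ≠ u ∧ w ≠ v) (σ : cay Coup ≃g cay Coup) (h₁ : σ 1 = 1) :
    ∃ b : Coup ≃g Coup, ∀ i j, Coup.Adj i j → σ (swap i j) = swap (b i) (b j) := by
  have hex : ∀ e : Sym2 (Fin n), ∃ e' : Sym2 (Fin n), e ∈ Coup.edgeSet → e' ∈ Coup.edgeSet ∧
      ∀ i j a b, e = s(i, j) → e' = s(a, b) → σ (swap i j) = swap a b := by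
    intro e
    by_cases he : e ∈ Coup.edgeSet
    · induction e with | _ i j
      have := cay_adj_swap he 1
      rw [← σ.map_adj_iff, h₁, one_mul] at this
      obtain ⟨a, b, hab, h⟩ := cay_adj_iff.1 this
      rw [one_mul] at h
      refine ⟨s(a, b), fun _ => ⟨hab, fun i' j' a' b' h₁ h₂ => ?_⟩⟩
      rw [← swap_eq_of_sym2_eq h₁, h, swap_eq_of_sym2_eq h₂]
    · exact ⟨e, fun h => (he h).elim⟩
  choose β hβ using hex
  have h₁' : σ.symm 1 = 1 := by rw [← h₁, σ.symm_apply_apply, h₁]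
  have hσ : ∀ {i j a b}, s(i, j) ∈ Coup.edgeSet → β s(i, j) = s(a, b) →
      σ (swap i j) = swap a b := fun he h => (hβ _ he).2 _ _ _ _ rfl h
  have hσ' : ∀ {i j a b}, s(i, j) ∈ Coup.edgeSet → β s(i, j) = s(a, b) →
      σ.symm (swap a b) = swap i j := fun he h => by rw [← hσ he h, σ.symm_apply_apply]
  have hinj : ∀ e ∈ Coup.edgeSet, ∀ f ∈ Coup.edgeSet, β e = β f → e = f := by
    intro e he f hf hef
    induction e with | _ i j
    induction f with | _ k l
    obtain ⟨a, b, hab⟩ : ∃ a b, β s(k, l) = s(a, b) := by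
      induction β s(k, l) with | _ a b
      exact ⟨a, b, rfl⟩
    refine sym2_eq_of_swap_eq he.ne (σ.injective ?_)
    rw [hσ he (hef.trans hab), hσ hf hab]
  have hmeet : ∀ e ∈ Coup.edgeSet, ∀ f ∈ Coup.edgeSet, e ≠ f →
      ((∃ v, v ∈ e ∧ v ∈ f) ↔ ∃ v, v ∈ β e ∧ v ∈ β f) := by
    intro e he f hf hef
    have hβef : β e ≠ β f := fun h => hef (hinj e he f hf h)
    constructor
    · rintro ⟨v, ⟨j, rfl⟩, ⟨k, rfl⟩⟩
      by_contra hcon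
      have he' := (hβ _ he).1
      have hf' := (hβ _ hf).1
      have hs := fun a b => hσ' (a := a) (b := b) he
      have ht := fun a b => hσ' (a := a) (b := b) hf
      revert he' hf' hs ht hcon
      induction β s(v, j) with | _ a b
      induction β s(v, k) with | _ c d
      intro hcon he' hf' hs ht
      simp only [Sym2.mem_iff] at hcon
      exact not_meet_of_disjoint σ.symm h₁' he' hf' (fun h => hcon ⟨a, Or.inl rfl, Or.inl h⟩)
        (fun h => hcon ⟨a, Or.inl rfl, Or.inr h⟩) (fun h => hcon ⟨b, Or.inr rfl, Or.inl h⟩)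
        (fun h => hcon ⟨b, Or.inr rfl, Or.inr h⟩)
        he hf (fun h => hef (congrArg (s(v, ·)) h)) (hs a b rfl) (ht c d rfl)
    · rintro ⟨v, ⟨b, hb⟩, ⟨c, hc⟩⟩
      by_contra hcon
      have he' := (hβ _ he).1
      have hf' := (hβ _ hf).1
      rw [hb] at he' hβef
      rw [hc] at hf' hβef
      induction e with | _ i j
      induction f with | _ k l
      simp only [Sym2.mem_iff] at hcon
      exact not_meet_of_disjoint σ h₁ he hf (fun h => hcon ⟨i, Or.inl rfl, Or.inl h⟩)
        (fun h => hcon ⟨i, Or.inl rfl, Or.inr h⟩) (fun h => hcon ⟨j, Or.inr rfl, Or.inl h⟩)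
        (fun h => hcon ⟨j, Or.inr rfl, Or.inr h⟩)
        he' hf' (fun h => hβef (congrArg (s(v, ·)) h)) (hσ he hb) (hσ hf hc)
  obtain ⟨b, hb⟩ := exists_iso_of_edge_map hconn hV β (fun e he => (hβ e he).1) hinj hmeet (by
    intro e he f hf h hh hef heh hfh
    have hef' : β e ≠ β f := fun h' => hef (hinj e he f hf h')
    have heh' : β e ≠ β h := fun h' => heh (hinj e he h hh h')
    have hfh' : β f ≠ β h := fun h' => hfh (hinj f hf h hh h')
    have he' := (hβ _ he).1
    have hf' := (hβ _ hf).1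
    have hh' := (hβ _ hh).1
    constructor
    · intro hv
      by_contra hcon
      obtain ⟨v, hve, hvf, hvh⟩ := hv
      obtain ⟨i, j, k, h₁, h₂, h₃⟩ := triangle_of_pairwise_meet hef'
        ((hmeet e he f hf hef).1 ⟨v, hve, hvf⟩)
        ((hmeet e he h hh heh).1 ⟨v, hve, hvh⟩) ((hmeet f hf h hh hfh).1 ⟨v, hvf, hvh⟩) hcon
      obtain ⟨b, rfl⟩ := hve
      obtain ⟨c, rfl⟩ := hvf
      obtain ⟨d, rfl⟩ := hvh
      rw [h₁] at he'
      rw [h₂] at hf'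
      rw [h₃] at hh'
      exact not_star_of_triangle σ.symm h₁' he' hf' hh' he hf hh (fun h => hef (congrArg (s(v, ·)) h))
        (fun h => heh (congrArg (s(v, ·)) h)) (fun h => hfh (congrArg (s(v, ·)) h)) (hσ' he h₁) (hσ' hf h₂) (hσ' hh h₃)
    · intro hv
      by_contra hcon
      obtain ⟨v, hve, hvf, hvh⟩ := hv
      obtain ⟨i, j, k, rfl, rfl, rfl⟩ := triangle_of_pairwise_meet hef
        ((hmeet e he f hf hef).2 ⟨v, hve, hvf⟩)
        ((hmeet e he h hh heh).2 ⟨v, hve, hvh⟩) ((hmeet f hf h hh hfh).2 ⟨v, hvf, hvh⟩) hcon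
      obtain ⟨b, hb⟩ := hve
      obtain ⟨c, hc⟩ := hvf
      obtain ⟨d, hd⟩ := hvh
      rw [hb] at he' hef' heh'
      rw [hc] at hf' hef' hfh'
      rw [hd] at hh' heh' hfh'
      exact not_star_of_triangle σ h₁ he hf hh he' hf' hh' (fun h => hef' (congrArg (s(v, ·)) h))
        (fun h => heh' (congrArg (s(v, ·)) h)) (fun h => hfh' (congrArg (s(v, ·)) h)) (hσ he hb) (hσ hf hc) (hσ hh hd))
  exact ⟨b, fun i j hij => hσ hij (hb _ hij)⟩

end Cayley
-- Moved to one side, the product is `swap i j * swap i k * swap i k'`, a 4-cycle.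
theorem cherry_product_ne_swap {α : Type*} [DecidableEq α] {i j k k' a b : α} (hij : i ≠ j)
    (hik : i ≠ k) (hik' : i ≠ k') (hjk : j ≠ k) (hjk' : j ≠ k') (hkk' : k ≠ k') :
    swap i j * swap j k' * swap j i ≠ swap i k * swap i j * swap a b := by
  intro h
  have key : ∀ p, swap i j (swap i k (swap i j (swap j k' (swap j i p)))) = swap a b p := by
    intro p
    have := DFunLike.congr_fun h p
    simp only [Perm.mul_apply] at this
    rw [this, swap_apply_self, swap_apply_self]
  have h1 := key i
  have h2 := key j
  have h3 := key k
  have h4 := key k'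
  clear key h
  simp only [swap_apply_def] at *
  grind

theorem braid_relation {α : Type*} [DecidableEq α] {i j k : α} (hij : i ≠ j) (hik : i ≠ k)
    (hjk : j ≠ k) :
    swap i j * swap i k * swap i j = swap i k * swap i j * swap i k := by
  rw [mul_assoc, mul_assoc, swap_conj_swap hik hjk, swap_conj_swap hij hjk.symm, swap_comm]

/-! ### Recognizing the 4-cycle -/

section Cycle
variable {V : Type*} {G : SimpleGraph V}

theorem map_neighbors (c : G ≃g G) {p q r p' q' r' : V} (hp : c p = p') (hq : c q = q')
    (hr : c r = r') (h : ∀ v, G.Adj p v ↔ v = q ∨ v = r) (v : V) :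
    G.Adj p' v ↔ v = q' ∨ v = r' := by
  subst hp hq hr
  obtain ⟨w, rfl⟩ := c.surjective v
  rw [c.map_adj_iff, h, c.injective.eq_iff, c.injective.eq_iff]

theorem nonempty_iso_cycleGraph_four (hG : G.Connected) {p q r s : V} (hpr : p ≠ r) (hqs : q ≠ s)
    (hp : ∀ v, G.Adj p v ↔ v = q ∨ v = s) (hq : ∀ v, G.Adj q v ↔ v = p ∨ v = r)
    (hr : ∀ v, G.Adj r v ↔ v = q ∨ v = s) (hs : ∀ v, G.Adj s v ↔ v = p ∨ v = r) :
    Nonempty (G ≃g cycleGraph 4) := by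
  have hpq : p ≠ q := ((hp q).2 (Or.inl rfl)).ne
  have hps : p ≠ s := ((hp s).2 (Or.inr rfl)).ne
  have hrq : r ≠ q := ((hr q).2 (Or.inl rfl)).ne
  have hrs : r ≠ s := ((hr s).2 (Or.inr rfl)).ne
  have hinj : Function.Injective ![p, q, r, s] := by
    intro a b hab
    fin_cases a <;> fin_cases b <;> simp_all
  have hsurj : Function.Surjective ![p, q, r, s] := by
    intro v
    by_contra hv
    obtain ⟨a, ⟨m, rfl⟩, y, hy, hay⟩ := exists_adj_leaving (S := Set.range ![p, q, r, s]) hG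
      ⟨0, rfl⟩ hv
    have hy' : y ≠ p ∧ y ≠ q ∧ y ≠ r ∧ y ≠ s :=
      ⟨fun h => hy ⟨0, h.symm⟩, fun h => hy ⟨1, h.symm⟩, fun h => hy ⟨2, h.symm⟩,
        fun h => hy ⟨3, h.symm⟩⟩
    fin_cases m
    · exact ((hp y).1 hay).elim hy'.2.1 hy'.2.2.2
    · exact ((hq y).1 hay).elim hy'.1 hy'.2.2.1
    · exact ((hr y).1 hay).elim hy'.2.1 hy'.2.2.2
    · exact ((hs y).1 hay).elim hy'.1 hy'.2.2.1
  have hcyc : ∀ a b : Fin 4, (cycleGraph 4).Adj a b ↔ a.val % 2 ≠ b.val % 2 := by decide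
  let E : cycleGraph 4 ≃g G := ⟨Equiv.ofBijective _ ⟨hinj, hsurj⟩, by
    intro a b
    change G.Adj (![p, q, r, s] a) (![p, q, r, s] b) ↔ _
    rw [hcyc]
    fin_cases a <;> fin_cases b <;>
      simp [hp, hq, hr, hs, hpq, hps, hrq, hrs, hpq.symm, hps.symm, hrq.symm, hrs.symm]⟩
  exact ⟨E.symm⟩

end Cycle

/-! ### The local action is constant along arcs -/

section Turn
variable {n : ℕ} {Coup : SimpleGraph (Fin n)}

/-- `b` describes the action of `ρ` on the arcs of the Cayley graph. -/
def IsLocalAction (ρ : Perm (Fin n) → Perm (Fin n)) (b : Perm (Fin n) → (Coup ≃g Coup)) : Prop :=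
  ∀ x i j, Coup.Adj i j → ρ (x * swap i j) = ρ x * swap (b x i) (b x j)

/-- The change of the local action along the arc from `x` to `x * swap i j`. -/
def turn (b : Perm (Fin n) → (Coup ≃g Coup)) (x : Perm (Fin n)) (i j : Fin n) : Coup ≃g Coup :=
  (b x)⁻¹ * b (x * swap i j)

/-- The displacement `ρ x ↦ ρ (x * y)`, read in the local coordinates at `x`. -/
def displacement (ρ : Perm (Fin n) → Perm (Fin n)) (b : Perm (Fin n) → (Coup ≃g Coup))
    (x y : Perm (Fin n)) : Perm (Fin n) :=
  (b x).toEquiv⁻¹ * ((ρ x)⁻¹ * ρ (x * y)) * (b x).toEquiv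

variable {ρ : Perm (Fin n) → Perm (Fin n)} {b : Perm (Fin n) → (Coup ≃g Coup)}

theorem turn_comm (x : Perm (Fin n)) (i j : Fin n) : turn b x i j = turn b x j i := by
  rw [turn, turn, swap_comm]

theorem apply_turn (x : Perm (Fin n)) (i j v : Fin n) :
    b x (turn b x i j v) = b (x * swap i j) v := by
  rw [← RelIso.mul_apply, turn, mul_inv_cancel_left]

/-- In coordinates at `x`, `ρ` keeps the first letter of a word and twists the second by the `turn`
along the first. Two words for one permutation have the same displacement, so every relation
constrains the turns. -/
theorem displacement_two (h : IsLocalAction ρ b) (x : Perm (Fin n)) {i j k l : Fin n}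
    (hij : Coup.Adj i j) (hkl : Coup.Adj k l) :
    displacement ρ b x (swap i j * swap k l) =
      swap i j * swap (turn b x i j k) (turn b x i j l) := by
  rw [displacement, ← mul_assoc x, h _ _ _ hkl, h _ _ _ hij, ← apply_turn, ← apply_turn]
  have e : ∀ u v, swap (b x u) (b x v) = (b x).toEquiv * swap u v * (b x).toEquiv⁻¹ :=
    fun u v => swap_apply_apply (b x).toEquiv u v
  simp only [e]
  group

theorem displacement_three (h : IsLocalAction ρ b) (x : Perm (Fin n)) {i j k l p q : Fin n}
    (hij : Coup.Adj i j) (hkl : Coup.Adj k l) (hpq : Coup.Adj p q) :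
    displacement ρ b x (swap i j * swap k l * swap p q) =
      swap i j * swap (turn b x i j k) (turn b x i j l) *
        swap (turn b x i j (turn b (x * swap i j) k l p))
          (turn b x i j (turn b (x * swap i j) k l q)) := by
  rw [← displacement_two h x hij hkl, displacement, displacement, ← mul_assoc x, ← mul_assoc x,
    h _ _ _ hpq, ← apply_turn (x * swap i j) k l, ← apply_turn (x * swap i j) k l, ← apply_turn,
    ← apply_turn]
  have e : ∀ u v, swap (b x u) (b x v) = (b x).toEquiv * swap u v * (b x).toEquiv⁻¹ :=
    fun u v => swap_apply_apply (b x).toEquiv u v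
  simp only [e]
  group

theorem turn_ends (h : IsLocalAction ρ b) (x : Perm (Fin n)) {i j : Fin n}
    (hij : Coup.Adj i j) :
    (turn b x i j i = i ∧ turn b x i j j = j) ∨ (turn b x i j i = j ∧ turn b x i j j = i) := by
  have h₂ := displacement_two h x hij hij
  rw [swap_mul_self, displacement, mul_one, inv_mul_cancel, mul_one, inv_mul_cancel] at h₂
  have h₃ : swap (turn b x i j i) (turn b x i j j) = swap i j := by
    rw [← one_mul (swap (turn b x i j i) _), ← swap_mul_self i j, mul_assoc, ← h₂, mul_one]
  exact Sym2.eq_iff.1 (sym2_eq_of_swap_eq ((turn b x i j).injective.ne hij.ne) h₃)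

theorem turn_ends_of_left (h : IsLocalAction ρ b) {x : Perm (Fin n)} {i j : Fin n}
    (hij : Coup.Adj i j) (hi : turn b x i j i = i) : turn b x i j j = j := by
  rcases turn_ends h x hij with h | h
  · exact h.2
  · exact (hij.ne (hi.symm.trans h.1)).elim

theorem turn_swap_of_left (h : IsLocalAction ρ b) {x : Perm (Fin n)} {i j : Fin n}
    (hij : Coup.Adj i j) (hi : turn b x i j i ≠ i) : turn b x i j i = j ∧ turn b x i j j = i := by
  rcases turn_ends h x hij with h | h
  · exact (hi h.1).elim
  · exact h

theorem turn_ne_ends (h : IsLocalAction ρ b) (x : Perm (Fin n)) {i j k : Fin n}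
    (hij : Coup.Adj i j) (hki : k ≠ i) (hkj : k ≠ j) :
    turn b x i j k ≠ i ∧ turn b x i j k ≠ j := by
  have hi := (turn b x i j).injective.ne hki
  have hj := (turn b x i j).injective.ne hkj
  rcases turn_ends h x hij with ⟨h₁, h₂⟩ | ⟨h₁, h₂⟩ <;> rw [h₁] at hi <;> rw [h₂] at hj
  · exact ⟨hi, hj⟩
  · exact ⟨hj, hi⟩

theorem swap_mul_eq_of_swap_mul_eq {α : Type*} [DecidableEq α] {i j k l : α} {A B : Perm α}
    (h : swap i j * A = swap k l * B) (hA : A * A = 1) : swap k l * swap i j = B * A := by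
  have : swap k l * (swap i j * A) * A = B * A := by
    rw [h, ← mul_assoc, swap_mul_self, one_mul]
  rw [← this, mul_assoc, mul_assoc, hA, mul_one]

/-- From the commutation relation: the image edge is `k l` or `i j`, and the latter is excluded
because the turn preserves `{i, j}`. -/
theorem turn_disjoint_edge (h : IsLocalAction ρ b) (x : Perm (Fin n)) {i j k l : Fin n}
    (hij : Coup.Adj i j) (hkl : Coup.Adj k l) (hik : i ≠ k) (hil : i ≠ l) (hjk : j ≠ k)
    (hjl : j ≠ l) :
    s(turn b x i j k, turn b x i j l) = s(k, l) := by
  have hcomm : swap i j * swap k l = swap k l * swap i j := by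
    rw [mul_swap_eq_swap_mul, swap_apply_of_ne_of_ne hik.symm hjk.symm,
      swap_apply_of_ne_of_ne hil.symm hjl.symm]
  have h₂ := displacement_two h x hij hkl
  rw [hcomm, displacement_two h x hkl hij] at h₂
  have h₃ := swap_mul_eq_of_swap_mul_eq h₂.symm (swap_mul_self _ _)
  rcases factor_of_disjoint hkl.ne hij.ne hik.symm hjk.symm hil.symm hjl.symm
    ((turn b x i j).injective.ne hkl.ne) h₃ with h₄ | h₄
  · exact h₄
  · have h₅ := turn_ne_ends h x hij hik.symm hjk.symm
    rcases Sym2.eq_iff.1 h₄ with h₆ | h₆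
    · exact (h₅.1 h₆.1).elim
    · exact (h₅.2 h₆.1).elim

/-- The triangle relation confines the image of `i k` to the triangle, and the image of `k` avoids
`i` and `j`. -/
theorem turn_common_neighbor (h : IsLocalAction ρ b) (x : Perm (Fin n)) {i j k : Fin n}
    (hij : Coup.Adj i j) (hik : Coup.Adj i k) (hjk : Coup.Adj j k) : turn b x i j k = k := by
  have hrot : swap i j * swap i k = swap j k * swap i j := by
    rw [mul_swap_eq_swap_mul, swap_apply_left, swap_apply_of_ne_of_ne hik.ne.symm hjk.ne.symm]
  have h₂ := displacement_two h x hij hik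
  rw [hrot, displacement_two h x hjk hij] at h₂
  have h₃ := swap_mul_eq_of_swap_mul_eq h₂.symm (swap_mul_self _ _)
  rw [swap_comm i j] at h₃
  have h₄ := factor_of_threeCycle hij.ne.symm hik.ne.symm
    ((turn b x i j).injective.ne hik.ne) h₃
  have h₅ := turn_ne_ends h x hij hik.ne.symm hjk.ne.symm
  simp only [Sym2.eq_iff] at h₄
  grind

/-- If the ends of the edge `i j` are not exchanged, no neighbour of `i` is moved. -/
theorem turn_neighbor (h : IsLocalAction ρ b) (x : Perm (Fin n)) {i j k : Fin n}
    (hij : Coup.Adj i j) (hik : Coup.Adj i k) (hi : turn b x i j i = i) : turn b x i j k = k := by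
  by_cases hkj : k = j
  · rw [hkj]; exact turn_ends_of_left h hij hi
  by_cases hjk : Coup.Adj j k
  · exact turn_common_neighbor h x hij hik hjk
  have hj := turn_ends_of_left h hij hi
  by_contra hk
  have hik' : Coup.Adj i (turn b x i j k) := by
    rw [← (turn b x i j).map_adj_iff, hi] at hik
    exact hik
  -- Exchanging the ends of `i k` would send `j` to a neighbour of `k` not adjacent to `i`. The turn
  -- along `i j` preserves the edge from `k` to it, so maps `k` there; but the image of `k` is
  -- adjacent to `i`.
  have hfix : ∀ y, turn b y i k i = i := by
    intro y
    by_contra hd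
    obtain ⟨hdi, hdk⟩ := turn_swap_of_left h hik hd
    have h₁ : Coup.Adj k (turn b y i k j) := by
      rw [← (turn b y i k).map_adj_iff, hdi] at hij
      exact hij
    have h₂ : ¬ Coup.Adj i (turn b y i k j) := by
      rw [Coup.adj_comm, ← (turn b y i k).map_adj_iff, hdk] at hjk
      exact hjk
    have h₃ := (turn_ne_ends h y hik hij.ne.symm (Ne.symm hkj)).1
    have h₄ : j ≠ turn b y i k j := fun h => hjk (h ▸ h₁.symm)
    have h₅ := turn_disjoint_edge h x hij h₁ hik.ne h₃.symm (Ne.symm hkj) h₄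
    rcases Sym2.eq_iff.1 h₅ with h₆ | h₆
    · exact hk h₆.1
    · exact h₂ (h₆.1 ▸ hik')
  -- With `i` fixed by these turns, five of the six letters of the transformed braid relation pass
  -- through `i`.
  have hex := braid_relation hij.ne hik.ne (Ne.symm hkj)
  have h₃ := displacement_three h x hij hik hij
  rw [hex, displacement_three h x hik hij hik, hfix, hfix, hi] at h₃
  have hne := (turn_ne_ends h x hij hik.ne.symm hkj).2
  refine star_product_ne_swap hij.ne hik.ne hik'.ne (Ne.symm hkj) hne.symm (Ne.symm hk) ?_ ?_ ?_ ?_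
    h₃.symm
  · refine (turn b x i j).injective.ne ?_
    exact (turn_ne_ends h _ hik hij.ne.symm (Ne.symm hkj)).2
  · rw [← hi]
    conv_lhs => rw [hi]
    refine (turn b x i j).injective.ne ?_
    exact (turn_ne_ends h _ hik hij.ne.symm (Ne.symm hkj)).1
  · exact (turn_ne_ends h _ hik hij.ne.symm (Ne.symm hkj)).2
  · exact (turn_ne_ends h _ hik hij.ne.symm (Ne.symm hkj)).1

/-- A moved vertex is neither `i` nor `j` nor adjacent to them, so every edge at it is reversed. It
then has one neighbour, likewise moved, and the two form a component missing `i`. -/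
theorem turn_eq_one_of_left (hconn : Coup.Connected) (h : IsLocalAction ρ b) (x : Perm (Fin n))
    {i j : Fin n} (hij : Coup.Adj i j) (hi : turn b x i j i = i) : turn b x i j = 1 := by
  have hj := turn_ends_of_left h hij hi
  have hNi : ∀ k, Coup.Adj i k → turn b x i j k = k := fun k hk => turn_neighbor h x hij hk hi
  have hNj : ∀ k, Coup.Adj j k → turn b x i j k = k := fun k hk => by
    rw [turn_comm] at hj ⊢
    exact turn_neighbor h x hij.symm hk hj
  have hedge : ∀ k l, Coup.Adj k l → turn b x i j k ≠ k →
      turn b x i j k = l ∧ turn b x i j l = k := by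
    intro k l hkl hk
    have := turn_disjoint_edge h x hij hkl (fun e => hk (e ▸ hi))
      (fun e => hk (hNi k (e ▸ hkl.symm))) (fun e => hk (e ▸ hj))
      (fun e => hk (hNj k (e ▸ hkl.symm)))
    rcases Sym2.eq_iff.1 this with h₁ | h₁
    · exact (hk h₁.1).elim
    · exact h₁
  ext1 v
  by_contra hv
  change turn b x i j v ≠ v at hv
  obtain ⟨_, ha, m, -, hvm⟩ := exists_adj_leaving (S := {v}) hconn rfl
    (by rintro rfl; exact hv hi : i ∉ ({v} : Set (Fin n)))
  rw [Set.mem_singleton_iff.1 ha] at hvm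
  obtain ⟨h₁, h₂⟩ := hedge v m hvm hv
  have hm : turn b x i j m ≠ m := by rw [h₂]; exact hvm.ne
  obtain ⟨p, hp, y, hy, hpy⟩ := exists_adj_leaving (S := {v, m}) hconn (Set.mem_insert v _)
    (by rintro (rfl | rfl); exacts [hv hi, hm hi] : i ∉ ({v, m} : Set (Fin n)))
  rcases hp with hp | hp
  · rw [hp] at hpy
    exact hy (Or.inr ((hedge v y hpy hv).1.symm.trans h₁))
  · rw [Set.mem_singleton_iff.1 hp] at hpy
    exact hy (Or.inl ((hedge m y hpy hm).1.symm.trans h₂))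

/-- If the ends of the edge `i j` are exchanged, every neighbour of `i` is one of `j`. -/
theorem adj_of_turn_swap (hconn : Coup.Connected) (hC4 : IsEmpty (Coup ≃g cycleGraph 4))
    (h : IsLocalAction ρ b) (x : Perm (Fin n)) {i j k : Fin n}
    (hij : Coup.Adj i j) (hi : turn b x i j i = j) (hik : Coup.Adj i k) (hkj : k ≠ j) :
    Coup.Adj j k := by
  by_contra hjk
  obtain ⟨-, hj⟩ := turn_swap_of_left h hij (hi ▸ hij.ne.symm)
  obtain ⟨k', hk'⟩ : ∃ k', turn b x i j k = k' := ⟨_, rfl⟩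
  have hjk' : Coup.Adj j k' := by
    rw [← (turn b x i j).map_adj_iff, hi, hk'] at hik
    exact hik
  have hik' : ¬ Coup.Adj i k' := by
    rw [← (turn b x i j).map_adj_iff, hj, hk'] at hjk
    exact hjk
  have hkk' : k ≠ k' := fun e => hik' (e ▸ hik)
  have hk'i : k' ≠ i := hk' ▸ (turn_ne_ends h x hij hik.ne.symm hkj).1
  -- An edge `k m` with `m ≠ i` is disjoint from `i j`, hence preserved; since `k` goes to `k'`, it
  -- is reversed and `m = k'`.
  have hswap : ∀ m, Coup.Adj k m → m ≠ i → m = k' ∧ turn b x i j m = k := by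
    intro m hm hmi
    have := turn_disjoint_edge h x hij hm hik.ne hmi.symm hkj.symm (fun e => hjk (e ▸ hm.symm))
    rw [hk'] at this
    rcases Sym2.eq_iff.1 this with h₁ | h₁
    · exact (hkk' h₁.1.symm).elim
    · exact ⟨h₁.1.symm, h₁.2⟩
  -- Otherwise the ends of `i k` are exchanged; all four neighbourhoods are then forced and `Coup`
  -- is a 4-cycle.
  have htriv : ∀ y, turn b y i k = 1 := by
    intro y
    by_contra hne
    obtain ⟨hdi, hdk⟩ := turn_swap_of_left h hik (fun e => hne (turn_eq_one_of_left hconn h y hik e))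
    have h₁ : Coup.Adj k (turn b y i k j) := by
      rw [← (turn b y i k).map_adj_iff, hdi] at hij
      exact hij
    have h₂ := hswap _ h₁ (turn_ne_ends h y hik hij.ne.symm hkj.symm).1
    have hkk'adj : Coup.Adj k k' := h₂.1 ▸ h₁
    have hk'k : turn b x i j k' = k := (hswap k' hkk'adj hk'i).2
    have hNi : ∀ v, Coup.Adj i v ↔ v = j ∨ v = k := by
      refine fun v => ⟨fun hv => ?_, by rintro (rfl | rfl) <;> assumption⟩
      by_contra hcon
      push Not at hcon
      have h₃ : Coup.Adj k (turn b y i k v) := by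
        rw [← (turn b y i k).map_adj_iff, hdi] at hv
        exact hv
      have h₄ := (hswap _ h₃ (turn_ne_ends h y hik hv.ne.symm hcon.2).1).1
      exact hcon.1 ((turn b y i k).injective (h₄.trans h₂.1.symm))
    have hNk : ∀ v, Coup.Adj k v ↔ v = i ∨ v = k' := by
      refine fun v => ⟨fun hv => ?_, by rintro (rfl | rfl) <;> [exact hik.symm; assumption]⟩
      by_cases hvi : v = i
      · exact Or.inl hvi
      · exact Or.inr (hswap v hv hvi).1
    have hNj := map_neighbors (turn b x i j) hi hj hk' hNi
    have hNk' := map_neighbors (turn b x i j) hk' hi hk'k hNk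
    exact (not_nonempty_iff.2 hC4) (nonempty_iso_cycleGraph_four hconn hk'i.symm hkj.symm hNi hNj
      hNk' hNk)
  have hex := braid_relation hij.ne hik.ne hkj.symm
  have h₃ := displacement_three h x hij hik hij
  rw [hex, displacement_three h x hik hij hik, htriv, htriv, hk', hi] at h₃
  simp only [RelIso.one_apply, hi, hj] at h₃
  exact cherry_product_ne_swap hij.ne hik.ne hk'i.symm hkj.symm hjk'.ne hkk' h₃.symm

/-- If `i k` kept its ends, the triangle relation would reduce to `swap i j = swap i k`. -/
theorem turn_swap_of_turn_swap (hconn : Coup.Connected) (hC4 : IsEmpty (Coup ≃g cycleGraph 4))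
    (h : IsLocalAction ρ b) (x : Perm (Fin n)) {i j k : Fin n}
    (hij : Coup.Adj i j) (hi : turn b x i j i = j) (hik : Coup.Adj i k) :
    turn b x i k i = k := by
  by_cases hkj : k = j
  · rw [hkj]; exact hi
  have hjk := adj_of_turn_swap hconn hC4 h x hij hi hik hkj
  have h₂ := displacement_two h x hij hik
  rw [swap_mul_swap_rotate hij.ne hik.ne hjk.ne, displacement_two h x hik hjk, hi,
    turn_common_neighbor h x hij hik hjk, turn_common_neighbor h x hik hij hjk.symm] at h₂
  rcases turn_ends h x hik with h₃ | h₃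
  · rw [h₃.2] at h₂
    have h₄ := sym2_eq_of_swap_eq hik.ne (mul_right_cancel h₂)
    rcases Sym2.eq_iff.1 h₄ with h₅ | h₅
    · exact (hkj h₅.2).elim
    · exact (hij.ne h₅.1).elim
  · exact h₃.1

/-- One exchanged edge at `i` forces exchange on all edges at `i`. By `adj_of_turn_swap` the closed
neighbourhood of `i` is then a clique that no edge leaves, so `Coup` is complete. -/
theorem turn_eq_one (hconn : Coup.Connected) (hC4 : IsEmpty (Coup ≃g cycleGraph 4))
    (hKn : Coup ≠ ⊤) (h : IsLocalAction ρ b) (x : Perm (Fin n)) {i j : Fin n}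
    (hij : Coup.Adj i j) : turn b x i j = 1 := by
  by_contra hne
  obtain ⟨hi, -⟩ := turn_swap_of_left h hij (fun e => hne (turn_eq_one_of_left hconn h x hij e))
  have hall : ∀ k, Coup.Adj i k → turn b x i k i = k := fun k hk =>
    turn_swap_of_turn_swap hconn hC4 h x hij hi hk
  have hsub : ∀ k v, Coup.Adj i k → Coup.Adj i v → v ≠ k → Coup.Adj k v := fun k v hk hv hvk =>
    adj_of_turn_swap hconn hC4 h x hk (hall k hk) hv hvk
  have hsup : ∀ k v, Coup.Adj i k → Coup.Adj k v → v ≠ i → Coup.Adj i v := fun k v hk hv hvi => by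
    refine adj_of_turn_swap hconn hC4 h x hk.symm ?_ hv hvi
    rw [turn_comm]
    exact (turn_swap_of_left h hk (by rw [hall k hk]; exact hk.ne.symm)).2
  have hcov : ∀ v, v ≠ i → Coup.Adj i v := by
    by_contra! hcon
    obtain ⟨v, hvi, hv⟩ := hcon
    obtain ⟨a, ha, y, hy, hay⟩ := exists_adj_leaving (S := {v | v = i ∨ Coup.Adj i v}) hconn
      (Or.inl rfl : i ∈ _) (by rintro (e | e); exacts [hvi e, hv e] : v ∉ _)
    rcases ha with ha | ha
    · exact hy (Or.inr (ha ▸ hay))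
    · exact hy (Or.inr (hsup a y ha hay (fun e => hy (Or.inl e))))
  apply hKn
  ext u v
  rw [top_adj]
  refine ⟨fun e => e.ne, fun huv => ?_⟩
  by_cases hu : u = i
  · rw [hu]; exact hcov v (fun e => huv (hu.trans e.symm))
  by_cases hv : v = i
  · rw [hv]; exact (hcov u hu).symm
  exact hsub u v (hcov u hu) (hcov v hv) huv.symm

end Turn

/-! ### Every automorphism is a two-sided translation -/

section Translation
variable {n : ℕ} {Coup : SimpleGraph (Fin n)}

/-- The map `x ↦ a x b⁻¹` as an automorphism of the Cayley graph. -/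
def biTranslation (a : Perm (Fin n)) (b : Coup ≃g Coup) : cay Coup ≃g cay Coup where
  toFun x := a * x * b.toEquiv⁻¹
  invFun x := a⁻¹ * x * b.toEquiv
  left_inv x := by group
  right_inv x := by group
  map_rel_iff' {x y} := by
    change (cay Coup).Adj (a * x * b.toEquiv⁻¹) (a * y * b.toEquiv⁻¹) ↔ (cay Coup).Adj x y
    rw [cay_adj_iff, cay_adj_iff]
    have key : ∀ i j, a * x * b.toEquiv⁻¹ * swap (b i) (b j) = a * (x * swap i j) * b.toEquiv⁻¹ := by
      intro i j
      have e : swap (b i) (b j) = b.toEquiv * swap i j * b.toEquiv⁻¹ :=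
        swap_apply_apply b.toEquiv i j
      rw [e]
      group
    constructor
    · rintro ⟨i, j, hij, h⟩
      refine ⟨b.symm i, b.symm j, b.symm.map_adj_iff.2 hij, ?_⟩
      have := key (b.symm i) (b.symm j)
      rw [b.apply_symm_apply, b.apply_symm_apply, ← h] at this
      exact mul_left_cancel (mul_right_cancel this)
    · rintro ⟨i, j, hij, rfl⟩
      exact ⟨b i, b j, b.map_adj_iff.2 hij, (key i j).symm⟩

theorem biTranslation_apply (a : Perm (Fin n)) (b : Coup ≃g Coup) (x : Perm (Fin n)) :
    biTranslation a b x = a * x * b.toEquiv⁻¹ := rfl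

/-- The action of `S_n × Aut(Coup)` on the Cayley graph by two-sided translations. -/
def biTranslationHom (Coup : SimpleGraph (Fin n)) :
    Perm (Fin n) × (Coup ≃g Coup) →* (cay Coup ≃g cay Coup) where
  toFun p := biTranslation p.1 p.2
  map_one' := by
    ext1 x
    change 1 * x * (1 : Perm (Fin n))⁻¹ = x
    group
  map_mul' p q := by
    ext1 x
    change p.1 * q.1 * x * (p.2.toEquiv * q.2.toEquiv)⁻¹ =
      p.1 * (q.1 * x * q.2.toEquiv⁻¹) * p.2.toEquiv⁻¹
    group

theorem exists_third_vertex (hconn : Coup.Connected) (hKn : Coup ≠ ⊤) (u v : Fin n) :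
    ∃ w, w ≠ u ∧ w ≠ v := by
  by_contra! hcon
  apply hKn
  ext a c
  rw [top_adj]
  refine ⟨fun e => e.ne, fun hac => ?_⟩
  obtain ⟨x, hx, y, hy, hxy⟩ := exists_adj_leaving (S := {a}) hconn rfl (Ne.symm hac)
  rw [Set.mem_singleton_iff] at hx hy
  have : y = c := by
    have h₁ := hcon a
    have h₂ := hcon y
    have h₃ := hcon c
    grind
  rwa [← hx, ← this]

/-- At `x = 1` a trivial translation gives `a = b`; then `b` commutes with all transpositions, and a
third vertex makes it trivial. -/
theorem biTranslationHom_injective (hV : ∀ u v : Fin n, ∃ w, w ≠ u ∧ w ≠ v) :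
    Function.Injective (biTranslationHom Coup) := by
  rw [injective_iff_map_eq_one]
  rintro ⟨a, b⟩ hab
  have key : ∀ x, a * x * b.toEquiv⁻¹ = x := fun x => DFunLike.congr_fun hab x
  have ha : a = b.toEquiv := by
    have := key 1
    rwa [mul_one, mul_inv_eq_one] at this
  have hb : ∀ v, b v = v := by
    intro v
    by_contra hv
    obtain ⟨w, hwv, hw⟩ := hV v (b v)
    have h₁ := key (swap v w)
    rw [ha, mul_inv_eq_iff_eq_mul] at h₁
    have h₂ : b (swap v w v) = swap v w (b v) := DFunLike.congr_fun h₁ v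
    rw [swap_apply_left, swap_apply_of_ne_of_ne hv hw.symm] at h₂
    exact hwv (b.injective h₂)
  have hb' : b = 1 := by
    ext1 v
    exact hb v
  subst hb'
  exact Prod.ext ha rfl

theorem exists_isLocalAction (hconn : Coup.Connected)
    (hV : ∀ u v : Fin n, ∃ w, w ≠ u ∧ w ≠ v) (ρ : cay Coup ≃g cay Coup) :
    ∃ b : Perm (Fin n) → (Coup ≃g Coup), IsLocalAction ρ b := by
  have : ∀ x, ∃ b : Coup ≃g Coup, ∀ i j, Coup.Adj i j →
      ρ (x * swap i j) = ρ x * swap (b i) (b j) := by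
    intro x
    -- Left translations move the base point `x` and its image to the identity.
    have hσ : ∀ y, (biTranslation (ρ x)⁻¹ 1 * ρ * biTranslation x 1 : cay Coup ≃g cay Coup) y =
        (ρ x)⁻¹ * ρ (x * y) := fun y => by
      change (ρ x)⁻¹ * ρ (x * y * (1 : Perm (Fin n))⁻¹) * (1 : Perm (Fin n))⁻¹ = _
      rw [inv_one, mul_one, mul_one]
    obtain ⟨b, hb⟩ := exists_iso_of_map_one hconn hV
      (biTranslation (ρ x)⁻¹ 1 * ρ * biTranslation x 1) (by rw [hσ, mul_one, inv_mul_cancel])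
    refine ⟨b, fun i j hij => ?_⟩
    rw [← hb i j hij, hσ, mul_inv_cancel_left]
  choose b hb using this
  exact ⟨b, fun x i j hij => hb x i j hij⟩

theorem closure_transpositions (hconn : Coup.Connected) :
    Subgroup.closure (transpositions Coup) = ⊤ := by
  have hpre : MulAction.IsPretransitive (Subgroup.closure (transpositions Coup)) (Fin n) := by
    refine ⟨fun u v => ?_⟩
    by_contra hv
    obtain ⟨a, ⟨c, hc⟩, y, hy, hay⟩ := exists_adj_leaving hconn
      (S := {w | ∃ c : Subgroup.closure (transpositions Coup), c • u = w}) ⟨1, one_smul _ u⟩ hv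
    refine hy ⟨⟨swap a y, Subgroup.subset_closure ⟨a, y, hay, rfl⟩⟩ * c, ?_⟩
    rw [mul_smul, hc]
    exact swap_apply_left a y
  refine closure_of_isSwap_of_isPretransitive ?_
  rintro _ ⟨i, j, hij, rfl⟩
  exact ⟨i, j, hij.ne, rfl⟩

theorem biTranslationHom_surjective (hconn : Coup.Connected)
    (hC4 : IsEmpty (Coup ≃g cycleGraph 4)) (hKn : Coup ≠ ⊤) :
    Function.Surjective (biTranslationHom Coup) := by
  intro ρ
  obtain ⟨b, hb⟩ := exists_isLocalAction hconn (exists_third_vertex hconn hKn) ρ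
  have hstep : ∀ x, ∀ y ∈ transpositions Coup, (b x = b 1 ∧ ρ x = ρ 1 * ((b 1).toEquiv * x *
      (b 1).toEquiv⁻¹)) → (b (x * y) = b 1 ∧ ρ (x * y) = ρ 1 * ((b 1).toEquiv * (x * y) *
      (b 1).toEquiv⁻¹)) := by
    rintro x _ ⟨i, j, hij, rfl⟩ ⟨h₁, h₂⟩
    constructor
    · have := turn_eq_one hconn hC4 hKn hb x hij
      rw [turn, inv_mul_eq_one] at this
      rw [← this, h₁]
    · have e : swap (b 1 i) (b 1 j) = (b 1).toEquiv * swap i j * (b 1).toEquiv⁻¹ :=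
        swap_apply_apply (b 1).toEquiv i j
      rw [hb x i j hij, h₁, h₂, e]
      group
  have hall : ∀ x, b x = b 1 ∧ ρ x = ρ 1 * ((b 1).toEquiv * x * (b 1).toEquiv⁻¹) := by
    intro x
    have hx : x ∈ Subgroup.closure (transpositions Coup) := by
      rw [closure_transpositions hconn]
      exact Subgroup.mem_top x
    induction hx using Subgroup.closure_induction_right with
    | one => exact ⟨rfl, by group⟩
    | mul_right x hx y hy ih => exact hstep x y hy ih
    | mul_inv_cancel x hx y hy ih =>
      refine hstep x _ ?_ ih
      obtain ⟨i, j, hij, rfl⟩ := hy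
      exact ⟨i, j, hij, swap_inv i j⟩
  refine ⟨(ρ 1 * (b 1).toEquiv, b 1), ?_⟩
  ext1 x
  rw [(hall x).2]
  change ρ 1 * (b 1).toEquiv * x * (b 1).toEquiv⁻¹ = _
  group

end Translation

/-! ### Translations preserving the compliant set -/

section Gate

theorem exists_perm_map {n m : ℕ} {x y : Fin m → Fin n} (hx : Function.Injective x)
    (hy : Function.Injective y) : ∃ τ : Perm (Fin n), ∀ k, τ (x k) = y k := by
  obtain ⟨τ, hτ⟩ := (Perm.isMultiplyPretransitive (Fin n) m).exists_smul_eq ⟨x, hx⟩ ⟨y, hy⟩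
  exact ⟨τ, fun k => DFunLike.congr_fun hτ k⟩

variable {n : ℕ} {Coup : SimpleGraph (Fin n)}

/-- In a connected incomplete graph some two adjacent edges span no triangle. -/
theorem exists_induced_path (hconn : Coup.Connected) (hKn : Coup ≠ ⊤) :
    ∃ a v y, Coup.Adj a v ∧ Coup.Adj v y ∧ a ≠ y ∧ ¬ Coup.Adj a y := by
  by_contra! hcon
  apply hKn
  ext a c
  rw [top_adj]
  refine ⟨fun e => e.ne, fun hac => ?_⟩
  by_contra hnadj
  obtain ⟨x, hx, y, hy, hxy⟩ := exists_adj_leaving (S := {v | v = a ∨ Coup.Adj a v}) hconn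
    (Or.inl rfl : a ∈ _) (by rintro (e | e); exacts [hac e.symm, hnadj e] : c ∉ _)
  rcases hx with hx | hx
  · exact hy (Or.inr (hx ▸ hxy))
  · exact hy (Or.inr (hcon a x y hx hxy (fun e => hy (Or.inl e.symm))))

/-- Distinct pairs sharing a point can be moved to an edge and the non-edge of an induced path. If
they are disjoint, any two disjoint pairs are both edges or both non-edges, which only the 4-cycle
allows. -/
theorem eq_of_forall_perm (hconn : Coup.Connected) (hC4 : IsEmpty (Coup ≃g cycleGraph 4))
    (hKn : Coup ≠ ⊤) {g h : Sym2 (Fin n)} (hg : ¬ g.IsDiag) (hh : ¬ h.IsDiag)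
    (H : ∀ τ : Perm (Fin n), g.map τ ∈ Coup.edgeSet ↔ h.map τ ∈ Coup.edgeSet) : g = h := by
  by_contra hne
  obtain ⟨a, v, y, hav, hvy, hay, hnay⟩ := exists_induced_path hconn hKn
  by_cases hmeet : ∃ p, p ∈ g ∧ p ∈ h
  · obtain ⟨p, ⟨q, rfl⟩, ⟨r, rfl⟩⟩ := hmeet
    rw [Sym2.mk_isDiag_iff] at hg hh
    have hqr : q ≠ r := fun e => hne (congrArg (s(p, ·)) e)
    obtain ⟨τ, hτ⟩ := exists_perm_map (x := ![p, q, r]) (y := ![a, v, y])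
      (by intro i j hij; fin_cases i <;> fin_cases j <;> simp_all)
      (by
        intro i j hij
        have h₁ := hav.ne
        have h₂ := hvy.ne
        fin_cases i <;> fin_cases j <;> simp_all)
    have h₀ : τ p = a := hτ 0
    have h₁ : τ q = v := hτ 1
    have h₂ : τ r = y := hτ 2
    have := H τ
    simp only [Sym2.map_mk, h₀, h₁, h₂, mem_edgeSet] at this
    exact hnay (this.1 hav)
  · induction g with | _ p q
    induction h with | _ r t
    rw [Sym2.mk_isDiag_iff] at hg hh
    simp only [Sym2.mem_iff, not_exists, not_and, not_or] at hmeet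
    have hp := hmeet p (Or.inl rfl)
    have hq := hmeet q (Or.inr rfl)
    have hiff : ∀ {a b c d : Fin n}, a ≠ b → a ≠ c → a ≠ d → b ≠ c → b ≠ d → c ≠ d →
        (Coup.Adj a b ↔ Coup.Adj c d) := by
      intro a b c d hab hac had hbc hbd hcd
      obtain ⟨τ, hτ⟩ := exists_perm_map (x := ![p, q, r, t]) (y := ![a, b, c, d])
        (by intro i j hij; fin_cases i <;> fin_cases j <;> simp_all)
        (by intro i j hij; fin_cases i <;> fin_cases j <;> simp_all)
      have h₀ : τ p = a := hτ 0
      have h₁ : τ q = b := hτ 1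
      have h₂ : τ r = c := hτ 2
      have h₃ : τ t = d := hτ 3
      have := H τ
      simpa only [Sym2.map_mk, h₀, h₁, h₂, h₃, mem_edgeSet] using this
    have hz : ∃ z, z ≠ a ∧ z ≠ v ∧ z ≠ y := by
      by_contra! hcon
      have h₁ := hcon p
      have h₂ := hcon q
      have h₃ := hcon r
      have h₄ := hcon t
      grind
    have hprop : ∀ z, z ≠ a → z ≠ v → z ≠ y → ¬ Coup.Adj v z ∧ Coup.Adj a z ∧ Coup.Adj y z := by
      intro z hza hzv hzy
      refine ⟨fun e => hnay ?_, ?_, ?_⟩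
      · exact (hiff hay hav.ne hza.symm hvy.ne.symm hzy.symm hzv.symm).2 e
      · exact (hiff hza.symm hav.ne hay hzv hzy hvy.ne).2 hvy
      · exact (hiff hzy.symm hay.symm hvy.ne.symm hza hzv hav.ne).2 hav
    obtain ⟨z, hza, hzv, hzy⟩ := hz
    obtain ⟨hvz, haz, hyz⟩ := hprop z hza hzv hzy
    -- A fifth vertex `w` would give the edge `a z` and the disjoint non-edge `w v`.
    have hcov : ∀ w, w = a ∨ w = v ∨ w = y ∨ w = z := by
      by_contra! hcon
      obtain ⟨w, hwa, hwv, hwy, hwz⟩ := hcon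
      exact (hprop w hwa hwv hwy).1
        ((hiff hza.symm hav.ne hwa.symm hzv hwz.symm hwv.symm).1 haz)
    have hirr : ∀ w, ¬ Coup.Adj w w := fun w e => e.ne rfl
    have hsymm : ∀ u w, Coup.Adj u w ↔ Coup.Adj w u := fun u w => Coup.adj_comm u w
    have hva := hav.ne
    have hyv := hvy.ne
    clear hiff hprop H hmeet
    refine not_nonempty_iff.2 hC4 (nonempty_iso_cycleGraph_four hconn hay hzv.symm ?_ ?_ ?_ ?_) <;>
    · intro w
      rcases hcov w with e | e | e | e <;> rw [e] <;> grind

theorem mem_autFixing_iff {V : Type*} {X : SimpleGraph V} {F : Set V} {ρ : X ≃g X} :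
    ρ ∈ autFixing X F ↔ ∀ x, ρ x ∈ F ↔ x ∈ F := by
  change ρ '' F = F ↔ _
  constructor
  · intro h x
    conv_lhs => rw [← h, ρ.injective.mem_set_image]
  · intro h
    ext y
    obtain ⟨x, rfl⟩ := ρ.surjective y
    rw [ρ.injective.mem_set_image, h]

theorem mem_symStabilizer_iff {g : Sym2 (Fin n)} {a : Perm (Fin n)} :
    a ∈ symStabilizer (g : Set (Fin n)) ↔ g.map (a⁻¹ : Perm (Fin n)) = g := by
  rw [← inv_mem_iff, MulAction.mem_stabilizer_iff]
  rw [← SetLike.coe_set_eq (p := g.map (a⁻¹ : Perm (Fin n)))]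
  have : (a⁻¹ • (g : Set (Fin n))) = (g.map (a⁻¹ : Perm (Fin n)) : Sym2 (Fin n)) := by
    ext v
    simp [Set.mem_smul_set, Sym2.mem_map]
  rw [this]

/-- The factor `b` drops out because it preserves edges; the factor `a` turns compliance with `g`
into compliance with `a⁻¹ g`. -/
theorem biTranslation_mem_autFixing_iff (hconn : Coup.Connected)
    (hC4 : IsEmpty (Coup ≃g cycleGraph 4)) (hKn : Coup ≠ ⊤) {g : Sym2 (Fin n)} (hg : ¬ g.IsDiag)
    (a : Perm (Fin n)) (b : Coup ≃g Coup) :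
    biTranslation a b ∈ autFixing (cay Coup) (compliant Coup g) ↔
      a ∈ symStabilizer (g : Set (Fin n)) := by
  have key : ∀ τ : Perm (Fin n), biTranslation a b τ ∈ compliant Coup g ↔
      (g.map (a⁻¹ : Perm (Fin n))).map (τ⁻¹ : Perm (Fin n)) ∈ Coup.edgeSet := by
    intro τ
    rw [biTranslation_apply]
    change g.map ((a * τ * b.toEquiv⁻¹)⁻¹ : Perm (Fin n)) ∈ Coup.edgeSet ↔ _
    induction g with | _ p q
    rw [mul_inv_rev, mul_inv_rev, inv_inv]
    exact b.map_adj_iff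
  rw [mem_autFixing_iff, mem_symStabilizer_iff]
  simp only [key]
  constructor
  · intro h
    refine eq_of_forall_perm hconn hC4 hKn ?_ hg fun τ => ?_
    · rwa [Sym2.isDiag_map (a⁻¹ : Perm (Fin n)).injective]
    · have := h τ⁻¹
      rwa [inv_inv] at this
  · intro h τ
    rw [h]
    rfl

end Gate
end NNCP

theorem mainTheorem3 (n : ℕ) (Coup : SimpleGraph (Fin n)) (hconn : Coup.Connected)
    (hC4 : IsEmpty (Coup ≃g SimpleGraph.cycleGraph 4)) (hKn : Coup ≠ ⊤)
    (g : Sym2 (Fin n)) (hg : ¬ g.IsDiag) :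
    Nonempty (NNCP.autFixing (NNCP.cay Coup) (NNCP.compliant Coup g) ≃*
      NNCP.symStabilizer (g : Set (Fin n)) × (Coup ≃g Coup)) := by
  have hinj := NNCP.biTranslationHom_injective (Coup := Coup)
    (NNCP.exists_third_vertex hconn hKn)
  have hmem := NNCP.biTranslation_mem_autFixing_iff hconn hC4 hKn hg
  let Φ : NNCP.symStabilizer (g : Set (Fin n)) × (Coup ≃g Coup) →*
      NNCP.autFixing (NNCP.cay Coup) (NNCP.compliant Coup g) :=
    ((NNCP.biTranslationHom Coup).comp
      ((NNCP.symStabilizer (g : Set (Fin n))).subtype.prodMap (MonoidHom.id _))).codRestrict _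
      fun p => (hmem p.1 p.2).2 p.1.2
  refine ⟨(MulEquiv.ofBijective Φ ⟨?_, ?_⟩).symm⟩
  · intro p q hpq
    have h := hinj (congrArg Subtype.val hpq)
    have h₁ := congrArg Prod.fst h
    have h₂ := congrArg Prod.snd h
    exact Prod.ext (Subtype.ext h₁) h₂
  · rintro ⟨ρ, hρ⟩
    obtain ⟨⟨a, b⟩, rfl⟩ := NNCP.biTranslationHom_surjective hconn hC4 hKn ρ
    exact ⟨(⟨a, (hmem a b).1 hρ⟩, b), rfl⟩
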